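/- Let $m\ge 1$, $X>0$, $y^0,\dots,y^{m-1}\in\mathbb R$, and let $a_0,\dots,a_{m-1},b\in C^1[0,X]$ be real-valued. Assume that for every $x\in[0,X]$ the Routh–Hurwitz condition $$(-1)^k\det\big(a_{ij}(x)\big)_{0\le i,j\le k-1}>0,\qquad k=1,\dots,m,$$ holds, where $a_{ij}=a_{2i-j}$ if $0\le 2i-j<m$, $a_{ij}=-1$ if $2i-j=m$, and $a_{ij}=0$ otherwise. Put $\bar y=-b/a_0$ on $[0,X]$. Let $\Pi$ be the solution of $\Pi^{(m)}=\sum_{j=0}^{m-1}a_j(0)\Pi^{(j)}$ with $\Pi(0)=y^0-\bar y(0)$, $\Pi^{(j)}(0)=y^j$ for $1\le j\le m-1$. For $x\in[0,X]$ let $\Phi^1(\cdot;x)$ and $\Phi^m(\cdot;x)$ be the solutions of $w^{(m)}=\sum_{j=0}^{m-1}a_j(x)w^{(j)}$ on $\mathbb R$ with $(w(0),\dots,w^{(m-1)}(0))$ equal to $(1,0,\dots,0)$ and $(0,\dots,0,1)$ respectively; a subscript $\xi^i$ denotes the $i$-th derivative in the first variable. For $\varepsilon>0$ let $$f(\xi;\varepsilon)=\varepsilon^{-1}\sum_{j=0}^{m-1}[a_j(\varepsilon\xi)-a_j(0)]\,\Pi^{(j)}(\xi)\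 \text{ if } m\ge2,\qquad f(\xi;\varepsilon)=\varepsilon^{-1}[a_0(\varepsilon\xi)-a_0(0)]\,\Pi(\xi)-\bar y'(\varepsilon\xi)\ \text{ if } m=1.$$ Let $C_m[0,X/\varepsilon]$ be the space of continuous functions $[0,X/\varepsilon]\to\mathbb R^m$, and for $z=(z^1,\dots,z^m)$ in it, $i=1,\dots,m$ and $\xi\in[0,X/\varepsilon]$ let $$\widehat A_i(\varepsilon)[z](\xi)=-\int_0^\xi\Phi^1_{\xi^{i-1}}(\xi-\zeta;\varepsilon\xi)\,\bar y'(\varepsilon\zeta)\,d\zeta+\int_0^\xi\Phi^m_{\xi^{i-1}}(\xi-\zeta;\varepsilon\xi)\Big\{\sum_{j=0}^{m-1}[a_j(\varepsilon\zeta)-a_j(\varepsilon\xi)]\,z^{j+1}(\zeta)+f(\zeta;\varepsilon)\Big\}d\zeta,$$ where the first integral is present only for $m\ge2$. Let $O(\vartheta,C_0;\varepsilon)$ be the set of $z\in C_m[0,X/\varepsilon]$ with $z(\xi)\in[-C_0,C_0]^m$ for all $\xi\in[0,X/\varepsilon]$. Then: 1. For every $\varepsilon>0$, $\widehat A(\varepsilon)=(\widehat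 A_1(\varepsilon),\dots,\widehat A_m(\varepsilon))$ maps $C_m[0,X/\varepsilon]$ into itself. 2. There exist $\varepsilon_0>0$ and $C_0\ge0$, with $C_0$ independent of $\varepsilon$, such that $\widehat A(\varepsilon)$ maps $O(\vartheta,C_0;\varepsilon)$ into itself for all $\varepsilon\in(0,\varepsilon_0]$. 3. These can be taken explicitly as follows. Consider constants $\chi>0$, $C_\Phi>0$ and $\tilde C$ such that, for all $i\in\{0,\dots,m-1\}$, $\xi\ge0$, $x\in[0,X]$, $$|\Phi^1_{\xi^i}(\xi;x)|,\ |\Phi^m_{\xi^i}(\xi;x)|\le C_\Phi(1+\xi^{m-1})e^{-\chi\xi},\qquad |\Pi^{(i)}(\xi)|\le\tilde C(1+\xi^{m-1})e^{-\chi\xi}.$$ Such constants exist; indeed, one may take $\chi=-\max\{\operatorname{Re}\lambda:\ \lambda^m=\sum_{j=0}^{m-1}a_j(x)\lambda^j,\ x\in[0,X]\}$, where the maximum is attained and negative. For any such $\chi,C_\Phi,\tilde C$ and any $\gamma_0\in(0,1)$, put, with $\|\cdot\|$ the maximum norm on $[0,X]$, $$\alpha=\sum_{j=0}^{m-1}\|a_j'\|,\qquad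 \beta=\alpha\,\frac{\chi^{m-1}+m!}{\chi^{m+1}},\qquad \gamma=\Big\{\tilde C\,\alpha\,\max_{\zeta>0}\big[(\zeta+\zeta^m)e^{-\chi\zeta}\big]+\|\bar y'\|\Big\}\frac{\chi^{m-1}+(m-1)!}{\chi^m}.$$ Then the assertion in 2 holds with $\varepsilon_0=\gamma_0/(C_\Phi\beta)>0$ (with $\varepsilon_0=+\infty$, i.e. for all $\varepsilon>0$, if $\beta=0$) and $C_0=C_\Phi\gamma/(1-\gamma_0)\ge0$. -/

import Mathlib

open Set

noncomputable section

namespace SingPert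

/-! ### Linear equations with constant coefficients -/

/-- `w` solves the initial-value problem
`w^(m) = c_{m-1} w^(m-1) + ... + c_0 w` on `ℝ`, `w^(j)(0) = N_j` for `j = 0, ..., m-1`. -/
def IsIVPSol {m : ℕ} (c N : Fin m → ℝ) (w : ℝ → ℝ) : Prop :=
  ContDiff ℝ m w ∧
  (∀ t : ℝ, iteratedDeriv m w t = ∑ j : Fin m, c j * iteratedDeriv (j : ℕ) w t) ∧
  ∀ j : Fin m, iteratedDeriv (j : ℕ) w 0 = N j

/-- The right-hand side of the equivalent first-order system
`z_0' = z_1, ..., z_{m-2}' = z_{m-1}, z_{m-1}' = c_{m-1} z_{m-1} + ... + c_0 z_0`. -/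
def companion {m : ℕ} (c : Fin m → ℝ) : (Fin m → ℝ) →L[ℝ] (Fin m → ℝ) :=
  ContinuousLinearMap.pi fun i : Fin m =>
    if h : (i : ℕ) + 1 < m then ContinuousLinearMap.proj ⟨(i : ℕ) + 1, h⟩
    else ∑ j : Fin m, c j • ContinuousLinearMap.proj j

/-- The solution of the initial-value problem `IsIVPSol c N`
(see `isIVPSol_ivpSol` and `IsIVPSol.eq_ivpSol`). -/
def ivpSol {m : ℕ} [NeZero m] (c N : Fin m → ℝ) (t : ℝ) : ℝ :=
  NormedSpace.exp (t • companion c) N 0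

theorem hasDerivAt_flow {m : ℕ} (c N : Fin m → ℝ) (t : ℝ) (i : Fin m) :
    HasDerivAt (fun s : ℝ => NormedSpace.exp (s • companion c) N i)
      (companion c (NormedSpace.exp (t • companion c) N) i) t := by
  have h := (hasDerivAt_exp_smul_const' (𝕂 := ℝ) (companion c) t).clm_apply
    (hasDerivAt_const t N)
  have h2 := (hasDerivAt_pi.1 h) i
  simpa using h2

theorem iteratedDeriv_ivpSol {m : ℕ} [NeZero m] (c N : Fin m → ℝ) (k : ℕ) (hk : k < m) :
    iteratedDeriv k (ivpSol c N) =
      fun t => NormedSpace.exp (t • companion c) N ⟨k, hk⟩ := by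
  induction k with
  | zero =>
    rw [iteratedDeriv_zero]
    rfl
  | succ k ih =>
    rw [iteratedDeriv_succ, ih (by omega)]
    funext t
    rw [(hasDerivAt_flow c N t ⟨k, by omega⟩).deriv]
    simp [companion, hk]

theorem iteratedDeriv_ivpSol_top {m : ℕ} [NeZero m] (c N : Fin m → ℝ) (t : ℝ) :
    HasDerivAt (iteratedDeriv (m - 1) (ivpSol c N))
      (∑ j : Fin m, c j * iteratedDeriv (j : ℕ) (ivpSol c N) t) t := by
  have hm : 0 < m := Nat.pos_of_neZero m
  rw [iteratedDeriv_ivpSol c N (m - 1) (by omega)]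
  have h := hasDerivAt_flow c N t ⟨m - 1, by omega⟩
  have e : companion c (NormedSpace.exp (t • companion c) N) ⟨m - 1, by omega⟩ =
      ∑ j : Fin m, c j * iteratedDeriv (j : ℕ) (ivpSol c N) t := by
    have hn : ¬ (m - 1 + 1 < m) := by omega
    simp only [companion, ContinuousLinearMap.coe_pi', hn, dite_false]
    simp only [_root_.sum_apply, _root_.smul_apply,
      ContinuousLinearMap.proj_apply, smul_eq_mul]
    refine Finset.sum_congr rfl fun j _ => ?_
    rw [iteratedDeriv_ivpSol c N j j.2]
    rfl
  rw [e] at h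
  exact h

theorem isIVPSol_ivpSol {m : ℕ} [NeZero m] (c N : Fin m → ℝ) :
    IsIVPSol c N (ivpSol c N) := by
  have hm : 0 < m := Nat.pos_of_neZero m
  have hlast : iteratedDeriv m (ivpSol c N) =
      fun t => ∑ j : Fin m, c j * iteratedDeriv (j : ℕ) (ivpSol c N) t := by
    funext t
    obtain ⟨k, hk⟩ : ∃ k, m = k + 1 := ⟨m - 1, by omega⟩
    have h := (iteratedDeriv_ivpSol_top c N t).deriv
    rw [← iteratedDeriv_succ, Nat.sub_add_cancel hm] at h
    exact h
  have hdiff : ∀ k < m, Differentiable ℝ (iteratedDeriv k (ivpSol c N)) := by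
    intro k hk t
    rw [iteratedDeriv_ivpSol c N k hk]
    exact (hasDerivAt_flow c N t ⟨k, hk⟩).differentiableAt
  refine ⟨?_, fun t => congrFun hlast t, fun j => ?_⟩
  · refine contDiff_of_differentiable_iteratedDeriv (n := (m : ℕ∞)) fun k hk => ?_
    rcases (Nat.cast_le.1 hk).lt_or_eq with h | h
    · exact hdiff k h
    · rw [h, hlast]
      exact Differentiable.fun_sum fun j _ => (hdiff j j.2).const_mul (c j)
  · rw [iteratedDeriv_ivpSol c N j j.2]
    simp

theorem IsIVPSol.eq_ivpSol {m : ℕ} [NeZero m] {c N : Fin m → ℝ} {w : ℝ → ℝ}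
    (h : IsIVPSol c N w) : w = ivpSol c N := by
  have hm : 0 < m := Nat.pos_of_neZero m
  have key : ∀ v : ℝ → ℝ, IsIVPSol c N v → ∀ t : ℝ,
      HasDerivAt (fun s => fun i : Fin m => iteratedDeriv (i : ℕ) v s)
        (companion c (fun i : Fin m => iteratedDeriv (i : ℕ) v t)) t := by
    intro v hv t
    rw [hasDerivAt_pi]
    intro i
    have hd : HasDerivAt (iteratedDeriv (i : ℕ) v) (iteratedDeriv ((i : ℕ) + 1) v t) t := by
      rw [iteratedDeriv_succ]
      exact ((hv.1.differentiable_iteratedDeriv (i : ℕ)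
        (by exact_mod_cast i.2)) t).hasDerivAt
    have e : companion c (fun i : Fin m => iteratedDeriv (i : ℕ) v t) i =
        iteratedDeriv ((i : ℕ) + 1) v t := by
      by_cases hi : (i : ℕ) + 1 < m
      · simp [companion, hi]
      · have e : (i : ℕ) + 1 = m := by omega
        rw [e, hv.2.1 t]
        simp [companion, e]
    rw [e]
    exact hd
  have hu := ODE_solution_unique_univ (v := fun _ z => companion c z) (s := fun _ => Set.univ)
    (K := ‖companion c‖₊) (t₀ := 0)
    (fun _ => (companion c).lipschitz.lipschitzOnWith)
    (fun t => ⟨key w h t, Set.mem_univ _⟩)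
    (fun t => ⟨key _ (isIVPSol_ivpSol c N) t, Set.mem_univ _⟩)
    (by
      funext i
      rw [h.2.2 i, (isIVPSol_ivpSol c N).2.2 i])
  funext t
  have := congrFun (congrFun hu t) 0
  simpa using this

/-! ### The Routh--Hurwitz condition -/

/-- The entries `a_{ij}`: `a_{2i-j}` if `0 ≤ 2i-j < m`, `-1` if `2i-j = m`, and `0` otherwise. -/
def hurwitzEntry {m : ℕ} (c : Fin m → ℝ) (i j : ℕ) : ℝ :=
  if h : j ≤ 2 * i ∧ 2 * i - j < m then c ⟨2 * i - j, h.2⟩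
  else if 2 * i = m + j then -1 else 0

/-- The Routh--Hurwitz condition: `(-1)^k det (a_{ij})_{0 ≤ i, j < k} > 0` for `k = 1, ..., m`. -/
def RouthHurwitz {m : ℕ} (c : Fin m → ℝ) : Prop :=
  ∀ k : ℕ, 1 ≤ k → k ≤ m →
    0 < (-1 : ℝ) ^ k * (Matrix.of fun i j : Fin k => hurwitzEntry c i j).det

/-! ### The Cauchy problem and the objects built from it -/

/-- The data of the Cauchy problem
`ε^m y^(m) = ε^(m-1) a_{m-1}(x) y^(m-1) + ... + a_0(x) y + b(x)` on `(0, X]`,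
`y^(j)(0) = y0_j / ε^j` for `j = 0, ..., m-1`. -/
structure Problem (m : ℕ) where
  X : ℝ
  a : Fin m → ℝ → ℝ
  b : ℝ → ℝ
  y0 : Fin m → ℝ

namespace Problem

variable {m : ℕ} [NeZero m] (d : Problem m)

/-- The vector of coefficients `(a_0(x), ..., a_{m-1}(x))`. -/
def coeff (x : ℝ) : Fin m → ℝ := fun i => d.a i x

/-- `ybar(x) = - b(x) / a_0(x)`. -/
def ybar (x : ℝ) : ℝ := -(d.b x / d.a 0 x)

/-- The derivative of `ybar` on `[0, X]` (one-sided at the end points). -/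
def ybar' (x : ℝ) : ℝ := derivWithin d.ybar (Icc 0 d.X) x

/-- The boundary-layer function: the solution of
`Π^(m) = a_{m-1}(0) Π^(m-1) + ... + a_0(0) Π`,
`Π(0) = y0_0 - ybar(0)`, `Π^(j)(0) = y0_j` for `j = 1, ..., m-1`. -/
def bl : ℝ → ℝ :=
  ivpSol (d.coeff 0) (fun j => if j = 0 then d.y0 0 - d.ybar 0 else d.y0 j)

/-- `Φ^1(·; x)`: solution of the equation with coefficients `a_j(x)` and
initial values `1, 0, ..., 0`. -/
def Phi1 (x : ℝ) : ℝ → ℝ :=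
  ivpSol (d.coeff x) (fun j => if (j : ℕ) = 0 then 1 else 0)

/-- `Φ^m(·; x)`: solution of the equation with coefficients `a_j(x)` and
initial values `0, ..., 0, 1`. -/
def Phim (x : ℝ) : ℝ → ℝ :=
  ivpSol (d.coeff x) (fun j => if (j : ℕ) = m - 1 then 1 else 0)

/-- The inhomogeneity `f(ξ; ε)`. -/
def f (ε ξ : ℝ) : ℝ :=
  if 2 ≤ m then
    ε⁻¹ * ∑ j : Fin m, (d.a j (ε * ξ) - d.a j 0) * iteratedDeriv (j : ℕ) d.bl ξ
  else
    ε⁻¹ * ((d.a 0 (ε * ξ) - d.a 0 0) * d.bl ξ) - d.ybar' (ε * ξ)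

/-- The space `C_m[0, X/ε]`. A vector-function on `[0, X/ε]` is represented by a function on `ℝ`,
whose values outside `[0, X/ε]` play no role. -/
def Cm (ε : ℝ) : Set (ℝ → Fin m → ℝ) :=
  {z | ContinuousOn z (Icc 0 (d.X / ε))}

/-- The closed ball `O(0, C₀; ε)` of radius `C₀` about zero in `C_m[0, X/ε]`. -/
def closedNhd (C₀ ε : ℝ) : Set (ℝ → Fin m → ℝ) :=
  {z | z ∈ d.Cm ε ∧ ∀ ξ ∈ Icc 0 (d.X / ε), ∀ i, z ξ i ∈ Icc (-C₀) C₀}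

/-- The integral operator `Â(ε)`; the component `i : Fin m` is the one with the
`i`-th derivatives of `Φ^1` and `Φ^m` in `ξ`. -/
def Ahat (ε : ℝ) (z : ℝ → Fin m → ℝ) : ℝ → Fin m → ℝ := fun ξ i =>
  (if 2 ≤ m then
    -∫ ζ in (0 : ℝ)..ξ, iteratedDeriv (i : ℕ) (d.Phi1 (ε * ξ)) (ξ - ζ) * d.ybar' (ε * ζ)
  else 0) +
  ∫ ζ in (0 : ℝ)..ξ, iteratedDeriv (i : ℕ) (d.Phim (ε * ξ)) (ξ - ζ) *
    ((∑ j : Fin m, (d.a j (ε * ζ) - d.a j (ε * ξ)) * z ζ j) + d.f ε ζ)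

/-! ### The constants -/

/-- The real parts of the roots `λ` of `λ^m - a_{m-1}(x) λ^(m-1) - ... - a_0(x)`, `x ∈ [0, X]`. -/
def rootRe : Set ℝ :=
  {r | ∃ x ∈ Icc 0 d.X, ∃ l : ℂ,
    l ^ m - ∑ j : Fin m, (d.a j x : ℂ) * l ^ (j : ℕ) = 0 ∧ l.re = r}

/-- The estimate `|Φ^1_{ξ^i}(ξ; x)|, |Φ^m_{ξ^i}(ξ; x)| ≤ C_Φ (1 + ξ^(m-1)) e^{-χ ξ}`. -/
def PhiBound (χ CΦ : ℝ) : Prop :=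
  ∀ i : Fin m, ∀ ξ : ℝ, 0 ≤ ξ → ∀ x ∈ Icc 0 d.X,
    |iteratedDeriv (i : ℕ) (d.Phi1 x) ξ| ≤ CΦ * (1 + ξ ^ (m - 1)) * Real.exp (-(χ * ξ)) ∧
    |iteratedDeriv (i : ℕ) (d.Phim x) ξ| ≤ CΦ * (1 + ξ ^ (m - 1)) * Real.exp (-(χ * ξ))

/-- The estimate `|Π^(i)(ξ)| ≤ C (1 + ξ^(m-1)) e^{-χ ξ}`. -/
def BlBound (χ C : ℝ) : Prop :=
  ∀ i : Fin m, ∀ ξ : ℝ, 0 ≤ ξ →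
    |iteratedDeriv (i : ℕ) d.bl ξ| ≤ C * (1 + ξ ^ (m - 1)) * Real.exp (-(χ * ξ))

/-- The norm of `C[0, X]`. -/
def supNorm (g : ℝ → ℝ) : ℝ := sSup ((fun x => |g x|) '' Icc 0 d.X)

/-- `α = ‖a_{m-1}'‖ + ... + ‖a_0'‖`. -/
def alpha : ℝ := ∑ j : Fin m, d.supNorm (derivWithin (d.a j) (Icc 0 d.X))

/-- `β = α (χ^(m-1) + m!) / χ^(m+1)`. -/
def beta (χ : ℝ) : ℝ := d.alpha * ((χ ^ (m - 1) + (m.factorial : ℝ)) / χ ^ (m + 1))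

/-- `γ = (C α max_{ζ > 0} [(ζ + ζ^m) e^{-χ ζ}] + ‖ybar'‖) (χ^(m-1) + (m-1)!) / χ^m`. -/
def gamma (χ C : ℝ) : ℝ :=
  (C * d.alpha * sSup ((fun ζ : ℝ => (ζ + ζ ^ m) * Real.exp (-(χ * ζ))) '' Ioi 0) +
    d.supNorm d.ybar') * ((χ ^ (m - 1) + ((m - 1).factorial : ℝ)) / χ ^ m)

open Classical in
/-- `ε₀ = γ₀ / (C_Φ β)`, and `ε₀ = +∞` if `β = 0`. -/
def eps0 (χ CΦ γ₀ : ℝ) : EReal :=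
  if d.beta χ = 0 then ⊤ else ((γ₀ / (CΦ * d.beta χ) : ℝ) : EReal)

/-- `C₀ = C_Φ γ / (1 - γ₀)`. -/
def C0 (χ CΦ C γ₀ : ℝ) : ℝ := CΦ * d.gamma χ C / (1 - γ₀)

end Problem

end SingPert

end

namespace SingPert

/-! ### The Routh--Hurwitz criterion -/

/-! The theorem rests on a stability criterion, a decay estimate uniform in `x`, and one integral
inequality.

Stability (`RouthHurwitz.re_neg`): Routh's reduction lowers the degree of a polynomial while keeping
its Hurwitz determinants positive. For `s` in the closed right half-plane, induction gives that the
even part `E` and odd part `O` satisfy `Re (E * conj O) ≥ 0` and do not both vanish; a root there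
would force `E = -O`, hence both zero. The roots for all `x ∈ [0, X]` form a compact family, so the
largest real part is attained; it is negative and is called `-χ`.

Decay (`norm_le_of_prod_sub_smul_eq_zero`): by Cayley–Hamilton the product of the factors `A - λ`
over the roots annihilates every solution of `u' = A u`. Removing one factor at a time gives
`e^{-χt}` times a polynomial of degree below `m`. The constants see only a bound on the
coefficients, never the distances between roots, so they are uniform in `x` and lose nothing in `χ`.

Invariance (`Regular.abs_Ahat_le`): the mean value inequality turns the differences of the `a_j`
into `ε (ξ - ζ)` times `‖a_j'‖`. Integrating against the decaying kernels bounds the operator on the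
ball of radius `C₀` by `CΦ * (ε * β * C₀ + γ)`, which is at most `C₀` for the stated `ε₀` and `C₀`.
-/

/-- The entry `c_{2i-j}` of the Hurwitz matrix of a sequence `c`, zero for `2i < j`. -/
def hurwitzSeq (c : ℕ → ℝ) (i j : ℕ) : ℝ := if j ≤ 2 * i then c (2 * i - j) else 0

/-- One step of the Routh reduction. -/
noncomputable def routhStep (κ : ℝ) (c : ℕ → ℝ) (k : ℕ) : ℝ :=
  if Even k then c (k + 1) else c (k + 1) - κ * c (k + 2)

/-- The top row is `(c 0, 0, ..., 0)`, which leaves a single minor. Subtracting `κ` times the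
preceding column from each odd-indexed column of that minor produces the Hurwitz matrix of the
reduced sequence. -/
theorem det_hurwitzSeq_succ (c : ℕ → ℝ) (h1 : c 1 ≠ 0) (k : ℕ) :
    (Matrix.of fun i j : Fin (k + 1) => hurwitzSeq c i j).det =
      c 0 * (Matrix.of fun i j : Fin k => hurwitzSeq (routhStep (c 0 / c 1) c) i j).det := by
  rw [Matrix.det_succ_row_zero, Finset.sum_eq_single 0]
  · have h0 : hurwitzSeq c 0 0 = c 0 := by simp [hurwitzSeq]
    simp only [Matrix.of_apply, Fin.val_zero, pow_zero, one_mul, h0]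
    congr 1
    cases k with
    | zero => simp
    | succ k =>
      refine Matrix.det_eq_of_forall_col_eq_smul_add_pred
        (fun j : Fin k => if Even (j : ℕ) then c 0 / c 1 else 0) ?_ ?_
      · intro i
        simp [hurwitzSeq, routhStep]
        rfl
      · intro i j
        obtain ⟨i, hi⟩ := i
        obtain ⟨j, hj⟩ := j
        simp only [Matrix.submatrix_apply, Matrix.of_apply, Fin.succ_mk, Fin.castSucc_mk,
          Fin.succAbove_zero, hurwitzSeq]
        rcases Nat.even_or_odd j with hev | hodd
        · rw [if_pos hev]
          obtain ⟨l, rfl⟩ := hev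
          rcases lt_trichotomy l i with h | h | h
          · rw [if_pos (by omega), if_pos (by omega), if_pos (by omega), routhStep,
              if_neg (by rw [Nat.even_iff]; omega)]
            have e1 : 2 * (i + 1) - (l + l + 1 + 1) = 2 * i - (l + l + 1) + 1 := by omega
            have e2 : 2 * (i + 1) - (l + l + 1) = 2 * i - (l + l + 1) + 2 := by omega
            rw [e1, e2]
            ring
          -- The boundary entry: `κ = c 0 / c 1` is the value for which column subtraction leaves
          -- zero here.
          · subst h
            rw [if_pos (by omega), if_neg (by omega), if_pos (by omega)]
            have e1 : 2 * (l + 1) - (l + l + 1 + 1) = 0 := by omega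
            have e2 : 2 * (l + 1) - (l + l + 1) = 1 := by omega
            rw [e1, e2]
            field_simp
            ring
          · rw [if_neg (by omega), if_neg (by omega), if_neg (by omega)]
            ring
        · rw [if_neg (Nat.not_even_iff_odd.2 hodd)]
          obtain ⟨l, rfl⟩ := hodd
          by_cases h : 2 * l + 1 + 1 ≤ 2 * i
          · rw [if_pos (by omega), if_pos h, routhStep, if_pos (by rw [Nat.even_iff]; omega)]
            have e1 : 2 * (i + 1) - (2 * l + 1 + 1 + 1) = 2 * i - (2 * l + 1 + 1) + 1 := by omega
            rw [e1]
            ring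
          · rw [if_neg (by omega), if_neg h]
            ring
  · intro j _ hj
    have : ¬ ((j : ℕ) ≤ 2 * 0) := by
      have := Fin.val_ne_of_ne hj
      simp at this ⊢
      omega
    simp [hurwitzSeq]
    intro h
    exact absurd h (by simpa using hj)
  · simp

/-- The even and the odd part of a polynomial with positive Hurwitz determinants. -/
theorem even_odd_part_of_hurwitz (m : ℕ) (c : ℕ → ℝ) (hz : ∀ k, m < k → c k = 0)
    (hm : 0 < c m)
    (hD : ∀ k, 1 ≤ k → k ≤ m → 0 < (Matrix.of fun i j : Fin k => hurwitzSeq c i j).det)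
    (s : ℂ) (hs : 0 ≤ s.re) :
    let E := ∑ l ∈ Finset.range (m + 1), (c (2 * l) : ℂ) * s ^ (2 * l)
    let O := ∑ l ∈ Finset.range (m + 1), (c (2 * l + 1) : ℂ) * s ^ (2 * l + 1)
    0 ≤ (E * (starRingEnd ℂ) O).re ∧ ¬ (E = 0 ∧ O = 0) := by
  induction m generalizing c with
  | zero =>
    have := hz 1 (by omega)
    simp [this, hm.ne']
  | succ m ih =>
    have h0 : 0 < c 0 := by
      have := hD 1 le_rfl (by omega)
      simpa [hurwitzSeq] using this
    -- In degree one `c 1` is the leading coefficient; otherwise the second determinant is `c 0 * c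
    -- 1`.
    have h1 : 0 < c 1 := by
      rcases Nat.eq_zero_or_pos m with rfl | h
      · exact hm
      · have := hD 2 (by omega) (by omega)
        simp [Matrix.det_fin_two, hurwitzSeq] at this
        exact (mul_pos_iff_of_pos_left h0).1 this
    set κ := c 0 / c 1 with hκ
    have hκ0 : 0 < κ := div_pos h0 h1
    have key := ih (routhStep κ c)
      (by
        intro k hk
        simp [routhStep, hz (k + 1) (by omega), hz (k + 2) (by omega)])
      (by simpa [routhStep, hz (m + 2) (by omega)] using hm)
      (by
        intro k hk1 hk
        have := hD (k + 1) (by omega) (by omega)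
        rw [det_hurwitzSeq_succ c h1.ne' k] at this
        exact (mul_pos_iff_of_pos_left h0).1 this)
    intro E O
    obtain ⟨key1, key2⟩ := key
    set E' := ∑ l ∈ Finset.range (m + 1), (routhStep κ c (2 * l) : ℂ) * s ^ (2 * l) with hE'
    set O' := ∑ l ∈ Finset.range (m + 1), (routhStep κ c (2 * l + 1) : ℂ) * s ^ (2 * l + 1)
      with hO'
    have eO : O = s * E' := by
      simp only [O]
      rw [Finset.sum_range_succ, hz (2 * (m + 1) + 1) (by omega), hE', Finset.mul_sum]
      simp only [Complex.ofReal_zero, zero_mul, add_zero]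
      refine Finset.sum_congr rfl fun l _ => ?_
      simp [routhStep]
      ring
    have eE : E = κ * E' + s * O' := by
      have e1 : s * O' = ∑ l ∈ Finset.range (m + 1),
          ((c (2 * l + 2) : ℂ) * s ^ (2 * l + 2) - κ * (c (2 * l + 3) * s ^ (2 * l + 2))) := by
        rw [hO', Finset.mul_sum]
        refine Finset.sum_congr rfl fun l _ => ?_
        simp [routhStep]
        ring
      have e2 : (κ : ℂ) * E' = c 0 + ∑ l ∈ Finset.range (m + 1),
          (κ : ℂ) * (c (2 * l + 3) * s ^ (2 * l + 2)) := by
        rw [Finset.sum_range_succ, hz (2 * m + 3) (by omega), hE', Finset.sum_range_succ',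
          mul_add, Finset.mul_sum, add_comm]
        congr 1
        · simp [routhStep, hκ]
          rw [← Complex.ofReal_div, ← Complex.ofReal_mul]
          congr 1
          field_simp
        · simp [routhStep]
          refine Finset.sum_congr rfl fun l _ => ?_
          ring_nf
      have e3 : E = ∑ l ∈ Finset.range (m + 1), (c (2 * l + 2) : ℂ) * s ^ (2 * l + 2) + c 0 := by
        simp only [E]
        rw [Finset.sum_range_succ']
        simp [mul_add]
      rw [e1, e2, e3, Finset.sum_sub_distrib]
      ring
    constructor
    · rw [eE, eO]
      -- The real part of `O' * conj E'` equals that of `E' * conj O'`, so the induction hypothesis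
      -- applies; the other summand is nonnegative since `Re s ≥ 0`.
      have : ((κ * E' + s * O') * (starRingEnd ℂ) (s * E')).re =
          κ * Complex.normSq E' * s.re +
            Complex.normSq s * (E' * (starRingEnd ℂ) O').re := by
        simp [Complex.normSq_apply, Complex.mul_re, Complex.mul_im]
        ring
      rw [this]
      have := Complex.normSq_nonneg E'
      have := Complex.normSq_nonneg s
      positivity
    · rintro ⟨hE, hO⟩
      by_cases hs0 : s = 0
      · have : E = c 0 := by
          simp only [E]
          rw [Finset.sum_range_succ']
          simp [hs0]
        rw [this] at hE
        exact h0.ne' (by exact_mod_cast hE)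
      · have hE0 : E' = 0 := by
          rw [eO] at hO
          exact (mul_eq_zero.1 hO).resolve_left hs0
        refine key2 ⟨hE0, ?_⟩
        rw [eE, hE0, mul_zero, zero_add] at hE
        exact (mul_eq_zero.1 hE).resolve_left hs0

/-- Sufficiency of the Routh--Hurwitz condition: every root has negative real part. -/
theorem RouthHurwitz.re_neg {m : ℕ} {c : Fin m → ℝ} (h : RouthHurwitz c) {l : ℂ}
    (hl : l ^ m - ∑ j : Fin m, (c j : ℂ) * l ^ (j : ℕ) = 0) : l.re < 0 := by
  by_contra! hre
  -- Coefficients of the monic characteristic polynomial. Their signs are opposite to those in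
  -- `hurwitzEntry`, and the factor `(-1)^k` in the hypothesis absorbs this.
  let q : ℕ → ℝ := fun k => if hk : k < m then -c ⟨k, hk⟩ else if k = m then 1 else 0
  have hent : ∀ i j : ℕ, hurwitzEntry c i j = -hurwitzSeq q i j := by
    intro i j
    simp only [hurwitzEntry, hurwitzSeq, q]
    split_ifs <;> first | omega | simp
  have key := even_odd_part_of_hurwitz m q (fun k hk => by simp [q, not_lt.2 hk.le, hk.ne'])
    (by simp [q])
    (by
      intro k hk1 hk
      have := h k hk1 hk
      have e : (Matrix.of fun i j : Fin k => hurwitzEntry c i j) =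
          -(Matrix.of fun i j : Fin k => hurwitzSeq q i j) := by
        ext i j
        simp [hent]
      rw [e, Matrix.det_neg, Fintype.card_fin, ← mul_assoc, ← mul_pow] at this
      simpa using this) l hre
  obtain ⟨key1, key2⟩ := key
  set E := ∑ l_1 ∈ Finset.range (m + 1), (q (2 * l_1) : ℂ) * l ^ (2 * l_1)
  set O := ∑ l_1 ∈ Finset.range (m + 1), (q (2 * l_1 + 1) : ℂ) * l ^ (2 * l_1 + 1)
  have hEO : E + O = 0 := by
    have e1 : E + O = ∑ k ∈ Finset.range (2 * (m + 1)), (q k : ℂ) * l ^ k := by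
      simp only [E, O]
      generalize m + 1 = n
      induction n with
      | zero => simp
      | succ n ih =>
        rw [Finset.sum_range_succ, Finset.sum_range_succ, mul_add, Finset.sum_range_succ,
          Finset.sum_range_succ, ← ih]
        ring
    have e2 : ∑ k ∈ Finset.range (2 * (m + 1)), (q k : ℂ) * l ^ k =
        ∑ k ∈ Finset.range (m + 1), (q k : ℂ) * l ^ k := by
      symm
      refine Finset.sum_subset (fun k hk => ?_) fun k _ hk => ?_
      · simp at hk ⊢
        omega
      · have : m < k := by
          simp at hk
          omega
        simp [q, not_lt.2 this.le, this.ne']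
    rw [e1, e2, Finset.sum_range_succ, Finset.sum_range, ← hl]
    simp [q]
    ring
  -- At a root `Re (E * conj O) = -|O|²`, so nonnegativity forces `O = 0`.
  have hE : E = -O := eq_neg_of_add_eq_zero_left hEO
  have hO : O = 0 := by
    rw [hE, neg_mul, Complex.mul_conj] at key1
    simp at key1
    exact Complex.normSq_eq_zero.1 (le_antisymm key1 (Complex.normSq_nonneg _))
  exact key2 ⟨by rw [hE, hO, neg_zero], hO⟩

/-! ### Exponential decay of solutions -/

/-- Differentiation drops the top term of the truncated exponential series. This supplies the
majorant for the comparison argument in `norm_le_of_prod_sub_smul_eq_zero`. -/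
theorem hasDerivAt_expPartialSum (M K t : ℝ) (n : ℕ) :
    HasDerivAt (fun t : ℝ => ∑ k ∈ Finset.range (n + 1), M ^ k * t ^ k / k.factorial * K)
      (∑ k ∈ Finset.range n, M ^ k * t ^ k / k.factorial * (M * K)) t := by
  have h : HasDerivAt (fun t : ℝ => ∑ k ∈ Finset.range (n + 1), M ^ k * t ^ k / k.factorial * K)
      (∑ k ∈ Finset.range (n + 1), M ^ k * (k * t ^ (k - 1)) / k.factorial * K) t :=
    HasDerivAt.fun_sum fun k _ =>
      (((hasDerivAt_pow k t).const_mul (M ^ k)).div_const _).mul_const _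
  convert h using 1
  rw [Finset.sum_range_succ']
  simp only [Nat.cast_zero, zero_mul, mul_zero, zero_div, add_zero]
  refine Finset.sum_congr rfl fun k _ => ?_
  rw [Nat.factorial_succ]
  have : (k.factorial : ℝ) ≠ 0 := by positivity
  have : (k : ℝ) + 1 ≠ 0 := by positivity
  push_cast
  rw [pow_succ]
  field_simp

/-- Decay of a solution of `u' = A u` annihilated by a product of factors `A - λ`. -/
theorem norm_le_of_prod_sub_smul_eq_zero {E : Type*} [NormedAddCommGroup E] [NormedSpace ℂ E]
    (A : E →L[ℂ] E) (χ M : ℝ) (hM : 0 ≤ M) (L : List ℂ) (hL : ∀ l ∈ L, l.re ≤ -χ)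
    (hLM : ∀ l ∈ L, ‖A - l • (1 : E →L[ℂ] E)‖ ≤ M) (u : ℝ → E)
    (hu : ∀ t, HasDerivAt u (A (u t)) t)
    (hz : ∀ t, (L.map fun l => A - l • (1 : E →L[ℂ] E)).prod (u t) = 0) {t : ℝ} (ht : 0 ≤ t) :
    ‖u t‖ ≤ Real.exp (-(χ * t)) *
      ∑ k ∈ Finset.range L.length, M ^ k * t ^ k / k.factorial * ‖u 0‖ := by
  induction L using List.reverseRecOn generalizing u t with
  | nil =>
    have := hz t
    simp at this
    simp [this]
  | append_singleton L l ih =>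
    set B : E →L[ℂ] E := A - l • (1 : E →L[ℂ] E) with hB
    have hl : l.re ≤ -χ := hL l (by simp)
    have hBM : ‖B‖ ≤ M := hLM l (by simp)
    have hcomm : ∀ x, B (A x) = A (B x) := fun x => by simp [hB]
    -- Since `B` commutes with `A`, `B u` solves the same equation and is annihilated by the shorter
    -- product; its initial value costs one factor `M`.
    have hv : ∀ t, HasDerivAt (fun t => B (u t)) (A (B (u t))) t := fun t => by
      rw [← hcomm]
      exact (B.restrictScalars ℝ).hasFDerivAt.comp_hasDerivAt t (hu t)
    have hvb : ∀ s, 0 ≤ s → ‖B (u s)‖ ≤ Real.exp (-(χ * s)) *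
        ∑ k ∈ Finset.range L.length, M ^ k * s ^ k / k.factorial * (M * ‖u 0‖) := by
      intro s hs
      refine (ih (fun l hl => hL l (by simp [hl])) (fun l hl => hLM l (by simp [hl]))
        (fun t => B (u t)) hv (fun t => ?_) hs).trans ?_
      · simpa only [List.map_append, List.prod_append, List.map_cons, List.map_nil, List.prod_cons,
          List.prod_nil, mul_one, mul_apply_eq_comp] using hz t
      · gcongr
        exact (B.le_opNorm _).trans (by gcongr)
    -- Variation of constants: this curve runs from `e^{lt} u(0)` at `s = 0` to `u(t)` at `s = t`,
    -- and its speed involves only `B u`, which is already controlled.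
    have hw : ∀ s : ℝ, HasDerivAt (fun s : ℝ => Complex.exp (l * (t - s)) • u s)
        (Complex.exp (l * (t - s)) • B (u s)) s := by
      intro s
      have h1 : HasDerivAt (fun s : ℝ => Complex.exp (l * (t - s)))
          (Complex.exp (l * (t - s)) * (l * (0 - 1))) s :=
        (((hasDerivAt_const s (t : ℂ)).sub
          (Complex.ofRealCLM.hasDerivAt (x := s))).const_mul l).cexp
      have h2 := h1.smul (hu s)
      refine h2.congr_deriv ?_
      have e : B (u s) = A (u s) - l • u s := rfl
      rw [e, smul_sub, smul_smul, zero_sub, mul_neg, mul_neg, mul_one, neg_smul,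
        ← sub_eq_add_neg]
    have hn : ∀ s : ℝ, s ≤ t → ‖Complex.exp (l * (t - s))‖ ≤ Real.exp (-(χ * (t - s))) := by
      intro s hs
      rw [Complex.norm_exp, ← neg_mul]
      have : (l * (t - s)).re = l.re * (t - s) := by simp
      rw [this]
      exact Real.exp_le_exp.2 (mul_le_mul_of_nonneg_right hl (by linarith))
    have key := image_norm_le_of_norm_deriv_right_le_deriv_boundary (a := 0) (b := t)
      (f := fun s : ℝ => Complex.exp (l * (t - s)) • u s)
      (f' := fun s : ℝ => Complex.exp (l * (t - s)) • B (u s))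
      (B := fun s => Real.exp (-(χ * t)) *
        ∑ k ∈ Finset.range (L.length + 1), M ^ k * s ^ k / k.factorial * ‖u 0‖)
      (B' := fun s => Real.exp (-(χ * t)) *
        ∑ k ∈ Finset.range L.length, M ^ k * s ^ k / k.factorial * (M * ‖u 0‖))
      (fun s _ => (hw s).continuousAt.continuousWithinAt)
      (fun s _ => (hw s).hasDerivWithinAt)
      (by
        rw [Finset.sum_range_succ']
        simp only [norm_smul]
        have := hn 0 ht
        simp only [sub_zero] at this
        simp
        exact mul_le_mul_of_nonneg_right (by simpa using this) (norm_nonneg _))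
      (fun s => (hasDerivAt_expPartialSum M ‖u 0‖ s L.length).const_mul _)
      (by
        intro s hs
        rw [norm_smul]
        calc _ ≤ Real.exp (-(χ * (t - s))) * (Real.exp (-(χ * s)) *
              ∑ k ∈ Finset.range L.length, M ^ k * s ^ k / k.factorial * (M * ‖u 0‖)) :=
              mul_le_mul (hn s hs.2.le) (hvb s hs.1) (norm_nonneg _) (Real.exp_pos _).le
          _ = _ := by
              rw [← mul_assoc, ← Real.exp_add]
              congr 2
              ring)
      (right_mem_Icc.2 ht)
    simpa using key

/-- The complexification of `companion c`. -/
noncomputable def companionC {m : ℕ} (c : Fin m → ℝ) : (Fin m → ℂ) →L[ℂ] (Fin m → ℂ) :=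
  ContinuousLinearMap.pi fun i : Fin m =>
    if h : (i : ℕ) + 1 < m then ContinuousLinearMap.proj ⟨(i : ℕ) + 1, h⟩
    else ∑ j : Fin m, (c j : ℂ) • ContinuousLinearMap.proj j

theorem companionC_ofReal {m : ℕ} (c z : Fin m → ℝ) (i : Fin m) :
    companionC c (fun j => (z j : ℂ)) i = (companion c z i : ℝ) := by
  by_cases h : (i : ℕ) + 1 < m <;> simp [companionC, companion, h]

theorem norm_companionC_le {m : ℕ} (c : Fin m → ℝ) : ‖companionC c‖ ≤ 1 + ∑ j, |c j| := by
  have h0 : 0 ≤ ∑ j, |c j| := Finset.sum_nonneg fun _ _ => abs_nonneg _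
  refine ContinuousLinearMap.opNorm_le_bound _ (by positivity) fun z => ?_
  refine (pi_norm_le_iff_of_nonneg (by positivity)).2 fun i => ?_
  by_cases h : (i : ℕ) + 1 < m
  · simp only [companionC, ContinuousLinearMap.coe_pi', h, dite_true,
      ContinuousLinearMap.proj_apply]
    nlinarith [norm_le_pi_norm z ⟨i + 1, h⟩, mul_nonneg h0 (norm_nonneg z)]
  · have e : companionC c z i = ∑ j, (c j : ℂ) * z j := by simp [companionC, h]
    rw [e]
    calc _ ≤ ∑ j, |c j| * ‖z‖ := by
          refine norm_sum_le_of_le _ fun j _ => ?_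
          rw [norm_mul, Complex.norm_real, Real.norm_eq_abs]
          gcongr
          exact norm_le_pi_norm z j
      _ ≤ _ := by
          rw [← Finset.sum_mul]
          gcongr
          linarith

/-- The characteristic polynomial `λ^m - c_{m-1} λ^(m-1) - ... - c_0`. -/
noncomputable def charPoly {m : ℕ} (c : Fin m → ℝ) : Polynomial ℂ :=
  Polynomial.X ^ m - ∑ j : Fin m, Polynomial.C (c j : ℂ) * Polynomial.X ^ (j : ℕ)

theorem degree_sum_lt {m : ℕ} (c : Fin m → ℝ) :
    (∑ j : Fin m, Polynomial.C (c j : ℂ) * Polynomial.X ^ (j : ℕ)).degree < (m : WithBot ℕ) := by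
  refine (Polynomial.degree_sum_le _ _).trans_lt ?_
  refine (Finset.sup_lt_iff (WithBot.bot_lt_coe m)).2 fun j _ => ?_
  exact (Polynomial.degree_C_mul_X_pow_le _ _).trans_lt (WithBot.coe_lt_coe.2 j.2)

theorem monic_charPoly {m : ℕ} (c : Fin m → ℝ) : (charPoly c).Monic :=
  Polynomial.monic_X_pow_sub (degree_sum_lt c)

theorem natDegree_charPoly {m : ℕ} (c : Fin m → ℝ) : (charPoly c).natDegree = m := by
  refine Polynomial.natDegree_eq_of_degree_eq_some ?_
  rw [charPoly, Polynomial.degree_sub_eq_left_of_degree_lt] <;> rw [Polynomial.degree_X_pow]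
  exact degree_sum_lt c

theorem eval_charPoly {m : ℕ} (c : Fin m → ℝ) (l : ℂ) :
    (charPoly c).eval l = l ^ m - ∑ j : Fin m, (c j : ℂ) * l ^ (j : ℕ) := by
  simp [charPoly, Polynomial.eval_finsetSum]

theorem companionC_pow_apply_zero {m : ℕ} [NeZero m] (c : Fin m → ℝ) (k : ℕ) (hk : k < m)
    (z : Fin m → ℂ) : ((companionC c) ^ k) z 0 = z ⟨k, hk⟩ := by
  induction k generalizing z with
  | zero => rfl
  | succ k ih =>
    rw [pow_succ, mul_apply_eq_comp, ih (by omega)]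
    simp [companionC, hk]

/-- Cayley–Hamilton for a companion matrix. The zeroth coordinate of `p(A) z` vanishes by direct
computation. Coordinate `i` is the zeroth coordinate of `A^i p(A) z = p(A) A^i z`, hence vanishes
too. -/
theorem aeval_charPoly_companionC {m : ℕ} [NeZero m] (c : Fin m → ℝ) :
    Polynomial.aeval (companionC c) (charPoly c) = 0 := by
  have hm : 0 < m := Nat.pos_of_neZero m
  set A := companionC c with hA
  have h0 : ∀ z, Polynomial.aeval A (charPoly c) z 0 = 0 := by
    intro z
    have e1 : (A ^ m) z 0 = ∑ j : Fin m, (c j : ℂ) * z j := by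
      obtain ⟨k, rfl⟩ : ∃ k, m = k + 1 := ⟨m - 1, by omega⟩
      rw [pow_succ, mul_apply_eq_comp, companionC_pow_apply_zero c k (by omega)]
      simp [hA, companionC]
    have e2 : ∀ j : Fin m, (A ^ (j : ℕ)) z 0 = z j := fun j =>
      companionC_pow_apply_zero c j j.2 z
    have e3 : Polynomial.aeval A (charPoly c) =
        A ^ m - ∑ j : Fin m, (c j : ℂ) • A ^ (j : ℕ) := by
      simp only [charPoly, map_sub, map_sum, map_mul, map_pow, Polynomial.aeval_X,
        Polynomial.aeval_C, ← Algebra.smul_def]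
    rw [e3]
    simp only [_root_.sub_apply, _root_.sum_apply, _root_.smul_apply, Pi.sub_apply,
      Finset.sum_apply, Pi.smul_apply, e1, e2, smul_eq_mul, sub_self]
  ext z i
  have e := companionC_pow_apply_zero c i i.2 (Polynomial.aeval A (charPoly c) z)
  have hc : A ^ (i : ℕ) * Polynomial.aeval A (charPoly c) =
      Polynomial.aeval A (charPoly c) * A ^ (i : ℕ) := by
    have := (Polynomial.aeval A).map_mul (Polynomial.X ^ (i : ℕ)) (charPoly c)
    have h2 := (Polynomial.aeval A).map_mul (charPoly c) (Polynomial.X ^ (i : ℕ))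
    rw [mul_comm] at this
    simpa using this.symm.trans h2
  have e3 : (A ^ (i : ℕ)) (Polynomial.aeval A (charPoly c) z) 0 = 0 := by
    rw [← mul_apply_eq_comp, hc, mul_apply_eq_comp, h0]
  rw [e] at e3
  exact e3

/-- Cauchy's root bound. It bounds the factors `A - λ` and also confines the roots for all `x` to
one compact disc. -/
theorem norm_root_le {m : ℕ} [NeZero m] (c : Fin m → ℝ) {l : ℂ}
    (hl : l ^ m - ∑ j : Fin m, (c j : ℂ) * l ^ (j : ℕ) = 0) : ‖l‖ ≤ 1 + ∑ j, |c j| := by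
  have hm : 0 < m := Nat.pos_of_neZero m
  have h0 : 0 ≤ ∑ j, |c j| := Finset.sum_nonneg fun _ _ => abs_nonneg _
  by_contra! h
  have h1 : 1 ≤ ‖l‖ := by linarith
  have h2 : ‖l‖ * ‖l‖ ^ (m - 1) ≤ (∑ j, |c j|) * ‖l‖ ^ (m - 1) := by
    rw [← pow_succ', Nat.sub_add_cancel hm, ← norm_pow, sub_eq_zero.1 hl, Finset.sum_mul]
    refine norm_sum_le_of_le _ fun j _ => ?_
    rw [norm_mul, Complex.norm_real, Real.norm_eq_abs, norm_pow]
    gcongr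
    omega
  have := le_of_mul_le_mul_right h2 (by positivity)
  linarith

/-- Decay of the solutions of a constant-coefficient equation whose characteristic roots
have real part at most `-χ`. -/
theorem abs_iteratedDeriv_ivpSol_le {m : ℕ} [NeZero m] (c N : Fin m → ℝ) {χ S : ℝ}
    (hS : ∑ j, |c j| ≤ S)
    (hχ : ∀ l : ℂ, l ^ m - ∑ j : Fin m, (c j : ℂ) * l ^ (j : ℕ) = 0 → l.re ≤ -χ)
    (i : Fin m) {t : ℝ} (ht : 0 ≤ t) :
    |iteratedDeriv (i : ℕ) (ivpSol c N) t| ≤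
      (∑ k ∈ Finset.range m, (2 * (1 + S)) ^ k / k.factorial) * ‖N‖ * (1 + t ^ (m - 1)) *
        Real.exp (-(χ * t)) := by
  have hS0 : 0 ≤ S := (Finset.sum_nonneg fun _ _ => abs_nonneg _).trans hS
  set A := companionC c with hA
  set u : ℝ → Fin m → ℂ := fun t i => ((NormedSpace.exp (t • companion c) N i : ℝ) : ℂ) with hu
  have hroot : ∀ l ∈ (charPoly c).roots.toList,
      l ^ m - ∑ j : Fin m, (c j : ℂ) * l ^ (j : ℕ) = 0 := by
    intro l hl
    rw [Multiset.mem_toList, Polynomial.mem_roots (monic_charPoly c).ne_zero] at hl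
    rw [← eval_charPoly]
    exact hl
  have hprod : ((charPoly c).roots.toList.map fun l =>
      A - l • (1 : (Fin m → ℂ) →L[ℂ] (Fin m → ℂ))).prod = 0 := by
    have h1 := IsAlgClosed.splits (charPoly c)
    have h2 := h1.eq_prod_roots_of_monic (monic_charPoly c)
    have h3 := aeval_charPoly_companionC c
    rw [h2, ← Multiset.coe_toList (charPoly c).roots, Multiset.map_coe, Multiset.prod_coe,
      map_list_prod, List.map_map] at h3
    rw [← h3]
    congr 1
    refine List.map_congr_left fun l _ => ?_
    simp [hA, Algebra.algebraMap_eq_smul_one]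
  have hlen : (charPoly c).roots.toList.length = m := by
    rw [Multiset.length_toList, ← (IsAlgClosed.splits (charPoly c)).natDegree_eq_card_roots,
      natDegree_charPoly]
  -- `M = 2 * (1 + S)` because both `‖A‖` and every root are bounded by `1 + S`.
  have key := norm_le_of_prod_sub_smul_eq_zero A χ (2 * (1 + S)) (by positivity)
    (charPoly c).roots.toList (fun l hl => hχ l (hroot l hl))
    (fun l hl => by
      refine (norm_sub_le _ _).trans ?_
      have h1 := norm_companionC_le c
      have h2 := norm_root_le c (hroot l hl)
      have h3 : ‖l • (1 : (Fin m → ℂ) →L[ℂ] (Fin m → ℂ))‖ ≤ ‖l‖ := by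
        rw [norm_smul]
        exact mul_le_of_le_one_right (norm_nonneg _) ContinuousLinearMap.norm_id_le
      linarith)
    u
    (fun t => by
      rw [hasDerivAt_pi]
      intro i
      rw [hA, companionC_ofReal]
      exact (hasDerivAt_flow c N t i).ofReal_comp)
    (fun t => by rw [hprod]; rfl) ht
  rw [hlen] at key
  have hu0 : ‖u 0‖ ≤ ‖N‖ := by
    refine (pi_norm_le_iff_of_nonneg (norm_nonneg _)).2 fun i => ?_
    simpa [hu] using norm_le_pi_norm N i
  have hui : |iteratedDeriv (i : ℕ) (ivpSol c N) t| ≤ ‖u t‖ := by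
    rw [iteratedDeriv_ivpSol c N i i.2]
    have := norm_le_pi_norm (u t) i
    simpa [hu] using this
  refine hui.trans (key.trans ?_)
  rw [mul_comm]
  gcongr
  rw [Finset.sum_mul, Finset.sum_mul]
  refine Finset.sum_le_sum fun k hk => ?_
  have hk' : k ≤ m - 1 := by
    have := Finset.mem_range.1 hk
    omega
  have htk : t ^ k ≤ 1 + t ^ (m - 1) := by
    rcases le_total t 1 with h | h
    · linarith [pow_le_one₀ ht h (n := k), pow_nonneg ht (m - 1)]
    · linarith [pow_le_pow_right₀ h hk']
  calc _ = (2 * (1 + S)) ^ k / k.factorial * ‖u 0‖ * t ^ k := by ring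
    _ ≤ _ := by gcongr

/-! ### Integral estimates and parametric integrals -/

theorem pow_mul_exp_neg_le (n : ℕ) {χ t : ℝ} (hχ : 0 < χ) (ht : 0 ≤ t) :
    t ^ n * Real.exp (-(χ * t)) ≤ n.factorial / χ ^ n := by
  have h := Real.pow_div_factorial_le_exp (χ * t) (by positivity) n
  rw [mul_pow, div_le_iff₀ (by positivity)] at h
  rw [Real.exp_neg, ← div_eq_mul_inv, div_le_div_iff₀ (Real.exp_pos _) (by positivity)]
  linarith

/-- Integration by parts, the boundary term at `T` having the favourable sign. -/
theorem integral_pow_mul_exp_neg_le (n : ℕ) {χ T : ℝ} (hχ : 0 < χ) (hT : 0 ≤ T) :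
    ∫ t in (0 : ℝ)..T, t ^ n * Real.exp (-(χ * t)) ≤ n.factorial / χ ^ (n + 1) := by
  induction n with
  | zero =>
    have h : ∀ t ∈ uIcc 0 T, HasDerivAt (fun t => -(Real.exp (-(χ * t)) / χ))
        (t ^ 0 * Real.exp (-(χ * t))) t := by
      intro t _
      have := ((((hasDerivAt_id t).const_mul χ).neg.exp).div_const χ).neg
      refine this.congr_deriv ?_
      simp
      field_simp
    rw [intervalIntegral.integral_eq_sub_of_hasDerivAt h
      (Continuous.intervalIntegrable (by fun_prop) _ _)]
    have := Real.exp_pos (-(χ * T))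
    have h2 : 0 ≤ Real.exp (-(χ * T)) / χ := by positivity
    simp at h2 ⊢
    linarith
  | succ n ih =>
    have h : ∀ t ∈ uIcc 0 T, HasDerivAt (fun t => -(t ^ (n + 1) * Real.exp (-(χ * t)) / χ))
        (t ^ (n + 1) * Real.exp (-(χ * t)) -
          (n + 1) / χ * (t ^ n * Real.exp (-(χ * t)))) t := by
      intro t _
      have := (((hasDerivAt_pow (n + 1) t).mul
        ((hasDerivAt_id t).const_mul χ).neg.exp).div_const χ).neg
      refine this.congr_deriv ?_
      simp
      field_simp
      ring
    have e := intervalIntegral.integral_eq_sub_of_hasDerivAt h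
      (Continuous.intervalIntegrable (by fun_prop) _ _)
    rw [intervalIntegral.integral_sub (Continuous.intervalIntegrable (by fun_prop) _ _)
      (Continuous.intervalIntegrable (by fun_prop) _ _),
      intervalIntegral.integral_const_mul] at e
    have h2 : 0 ≤ T ^ (n + 1) * Real.exp (-(χ * T)) / χ := by positivity
    have h3 : (n + 1) / χ * ∫ t in (0 : ℝ)..T, t ^ n * Real.exp (-(χ * t)) ≤
        (n + 1) / χ * (n.factorial / χ ^ (n + 1)) := by gcongr
    have h4 : (n + 1) / χ * (n.factorial / χ ^ (n + 1)) =
        ((n + 1).factorial : ℝ) / χ ^ (n + 1 + 1) := by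
      rw [Nat.factorial_succ]
      push_cast
      field_simp
      ring
    simp only [ne_eq, Nat.add_eq_zero_iff, one_ne_zero, and_false, not_false_eq_true, zero_pow,
      zero_mul, zero_div, neg_zero, sub_zero] at e
    linarith

/-- Source of the fraction in `gamma`. -/
theorem integral_kernel_le (m : ℕ) [NeZero m] {χ T : ℝ} (hχ : 0 < χ) (hT : 0 ≤ T) :
    ∫ t in (0 : ℝ)..T, (1 + t ^ (m - 1)) * Real.exp (-(χ * t)) ≤
      (χ ^ (m - 1) + ((m - 1).factorial : ℝ)) / χ ^ m := by
  obtain ⟨k, rfl⟩ : ∃ k, m = k + 1 := ⟨m - 1, by have := NeZero.pos m; omega⟩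
  have e : ∀ t : ℝ, (1 + t ^ (k + 1 - 1)) * Real.exp (-(χ * t)) =
      t ^ 0 * Real.exp (-(χ * t)) + t ^ k * Real.exp (-(χ * t)) := fun t => by
    simp
    ring
  simp only [e]
  rw [intervalIntegral.integral_add (Continuous.intervalIntegrable (by fun_prop) _ _)
    (Continuous.intervalIntegrable (by fun_prop) _ _)]
  refine (add_le_add (integral_pow_mul_exp_neg_le 0 hχ hT)
    (integral_pow_mul_exp_neg_le k hχ hT)).trans_eq ?_
  simp
  field_simp
  ring

/-- Source of the fraction in `beta`; the extra factor `t` stands for `ξ - ζ` from the mean value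
inequality. -/
theorem integral_mul_kernel_le (m : ℕ) [NeZero m] {χ T : ℝ} (hχ : 0 < χ) (hT : 0 ≤ T) :
    ∫ t in (0 : ℝ)..T, t * ((1 + t ^ (m - 1)) * Real.exp (-(χ * t))) ≤
      (χ ^ (m - 1) + (m.factorial : ℝ)) / χ ^ (m + 1) := by
  obtain ⟨k, rfl⟩ : ∃ k, m = k + 1 := ⟨m - 1, by have := NeZero.pos m; omega⟩
  have e : ∀ t : ℝ, t * ((1 + t ^ (k + 1 - 1)) * Real.exp (-(χ * t))) =
      t ^ 1 * Real.exp (-(χ * t)) + t ^ (k + 1) * Real.exp (-(χ * t)) := fun t => by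
    simp [pow_succ]
    ring
  simp only [e]
  rw [intervalIntegral.integral_add (Continuous.intervalIntegrable (by fun_prop) _ _)
    (Continuous.intervalIntegrable (by fun_prop) _ _)]
  refine (add_le_add (integral_pow_mul_exp_neg_le 1 hχ hT)
    (integral_pow_mul_exp_neg_le (k + 1) hχ hT)).trans_eq ?_
  simp [pow_succ]
  field_simp

/-- Needed for the supremum in `gamma` to be a genuine upper bound: `sSup` of an unbounded set of
reals is `0`. -/
theorem bddAbove_add_pow_mul_exp (m : ℕ) {χ : ℝ} (hχ : 0 < χ) :
    BddAbove ((fun ζ : ℝ => (ζ + ζ ^ m) * Real.exp (-(χ * ζ))) '' Ioi 0) := by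
  refine ⟨(Nat.factorial 1 : ℝ) / χ ^ 1 + m.factorial / χ ^ m, ?_⟩
  rintro _ ⟨t, ht, rfl⟩
  have h1 := pow_mul_exp_neg_le 1 hχ (le_of_lt ht)
  have h2 := pow_mul_exp_neg_le m hχ (le_of_lt ht)
  rw [pow_one] at h1
  simp only [add_mul]
  exact add_le_add h1 h2

/-- Clamping both variables to `[0, T]` extends `F` continuously to the plane and changes nothing on
`0 ≤ ζ ≤ ξ ≤ T`. -/
theorem continuousOn_integral_of_continuousOn {T : ℝ} (hT : 0 ≤ T) {F : ℝ → ℝ → ℝ}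
    (hF : ContinuousOn (Function.uncurry F) (Icc 0 T ×ˢ Icc 0 T)) :
    ContinuousOn (fun ξ => ∫ ζ in (0 : ℝ)..ξ, F ξ ζ) (Icc 0 T) := by
  set p : ℝ → ℝ := fun x => (projIcc 0 T hT x : ℝ) with hp
  have hpc : Continuous p := continuous_subtype_val.comp continuous_projIcc
  have hpm : ∀ x, p x ∈ Icc 0 T := fun x => (projIcc 0 T hT x).2
  have hpe : ∀ x ∈ Icc 0 T, p x = x := fun x hx => by simp [hp, projIcc_of_mem hT hx]
  have hG : Continuous (Function.uncurry fun ξ ζ => F (p ξ) (p ζ)) :=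
    hF.comp_continuous (f := fun q : ℝ × ℝ => (p q.1, p q.2)) (by fun_prop)
      fun q => ⟨hpm _, hpm _⟩
  have h := intervalIntegral.continuous_parametric_intervalIntegral_of_continuous
    (μ := MeasureTheory.volume) (a₀ := 0) hG continuous_id
  refine h.continuousOn.congr fun ξ hξ => ?_
  refine intervalIntegral.integral_congr fun ζ hζ => ?_
  change ζ ∈ uIcc 0 ξ at hζ
  rw [uIcc_of_le hξ.1] at hζ
  simp only [hpe ξ hξ, hpe ζ ⟨hζ.1, hζ.2.trans hξ.2⟩]

theorem continuous_companion {m : ℕ} : Continuous (companion (m := m)) := by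
  have h : Continuous fun c : Fin m → ℝ => ContinuousLinearMap.pi (R := ℝ)
      fun i : Fin m => if h : (i : ℕ) + 1 < m then
        (ContinuousLinearMap.proj (R := ℝ) (φ := fun _ => ℝ) ⟨(i : ℕ) + 1, h⟩)
      else ∑ j : Fin m, c j • ContinuousLinearMap.proj j := by
    refine continuous_clm_apply.2 fun z => continuous_pi fun i => ?_
    by_cases h : (i : ℕ) + 1 < m
    · simpa [h] using continuous_const
    · simp only [ContinuousLinearMap.coe_pi', h, dite_false, _root_.sum_apply, _root_.smul_apply,
        ContinuousLinearMap.proj_apply, smul_eq_mul]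
      fun_prop
  exact h

/-- Joint continuity in time and coefficients is needed because `Ahat` evaluates the kernels at
coefficients depending on the upper limit `ξ`. -/
theorem continuous_iteratedDeriv_ivpSol {m : ℕ} [NeZero m] (N : Fin m → ℝ) (i : Fin m) :
    Continuous fun q : ℝ × (Fin m → ℝ) => iteratedDeriv (i : ℕ) (ivpSol q.2 N) q.1 := by
  have e : (fun q : ℝ × (Fin m → ℝ) => iteratedDeriv (i : ℕ) (ivpSol q.2 N) q.1) =
      fun q => NormedSpace.exp (q.1 • companion q.2) N i := by
    funext q
    rw [iteratedDeriv_ivpSol q.2 N i i.2]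
  rw [e]
  have h1 : Continuous fun q : ℝ × (Fin m → ℝ) => q.1 • companion q.2 :=
    continuous_fst.smul (continuous_companion.comp continuous_snd)
  let _ := NormedAlgebra.restrictScalars ℚ ℝ ((Fin m → ℝ) →L[ℝ] (Fin m → ℝ))
  have h2 : Continuous (NormedSpace.exp : ((Fin m → ℝ) →L[ℝ] (Fin m → ℝ)) → _) :=
    NormedSpace.exp_continuous
  exact (continuous_apply i).comp ((h2.comp h1).clm_apply continuous_const)

theorem continuousOn_iteratedDeriv_ivpSol_comp {m : ℕ} [NeZero m] (N : Fin m → ℝ) (i : Fin m)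
    {α : Type*} [TopologicalSpace α] {s : Set α} {c : α → Fin m → ℝ} {g : α → ℝ}
    (hc : ContinuousOn c s) (hg : ContinuousOn g s) :
    ContinuousOn (fun q => iteratedDeriv (i : ℕ) (ivpSol (c q) N) (g q)) s := by
  have h := (continuous_iteratedDeriv_ivpSol N i).comp_continuousOn (hg.prodMk hc)
  exact h

namespace Problem

/-! ### Norms and continuity of the data -/

theorem supNorm_nonneg {m : ℕ} (d : Problem m) (g : ℝ → ℝ) : 0 ≤ d.supNorm g := by
  refine Real.sSup_nonneg ?_
  rintro _ ⟨x, _, rfl⟩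
  exact abs_nonneg _

theorem abs_le_supNorm {m : ℕ} (d : Problem m) {g : ℝ → ℝ} (hg : ContinuousOn g (Icc 0 d.X)) {x : ℝ}
    (hx : x ∈ Icc 0 d.X) : |g x| ≤ d.supNorm g :=
  le_csSup (isCompact_Icc.bddAbove_image hg.abs) (mem_image_of_mem _ hx)

theorem alpha_nonneg {m : ℕ} (d : Problem m) :
    0 ≤ d.alpha := Finset.sum_nonneg fun _ _ => d.supNorm_nonneg _

theorem beta_nonneg {m : ℕ} (d : Problem m) {χ : ℝ} (hχ : 0 < χ) : 0 ≤ d.beta χ :=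
  mul_nonneg d.alpha_nonneg (by positivity)

theorem BlBound.nonneg {m : ℕ} [NeZero m] {d : Problem m} {χ C : ℝ} (h : d.BlBound χ C) :
    0 ≤ C := by
  have h0 := (abs_nonneg _).trans (h 0 0 le_rfl)
  have h1 : (0 : ℝ) < 1 + 0 ^ (m - 1) := by positivity
  rw [mul_zero, neg_zero, Real.exp_zero, mul_one] at h0
  exact nonneg_of_mul_nonneg_left h0 h1

theorem sSup_nonneg_add_pow_mul_exp (m : ℕ) (χ : ℝ) :
    0 ≤ sSup ((fun ζ : ℝ => (ζ + ζ ^ m) * Real.exp (-(χ * ζ))) '' Ioi 0) := by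
  refine Real.sSup_nonneg ?_
  rintro _ ⟨t, ht, rfl⟩
  have : (0 : ℝ) < t := ht
  positivity

theorem gamma_nonneg {m : ℕ} [NeZero m] (d : Problem m) {χ C : ℝ} (hχ : 0 < χ) (hC : 0 ≤ C) :
    0 ≤ d.gamma χ C :=
  mul_nonneg (add_nonneg (mul_nonneg (mul_nonneg hC d.alpha_nonneg)
    (sSup_nonneg_add_pow_mul_exp m χ)) (d.supNorm_nonneg _)) (by positivity)

theorem C0_nonneg {m : ℕ} [NeZero m] (d : Problem m) {χ CΦ C γ₀ : ℝ} (hχ : 0 < χ) (hCΦ : 0 < CΦ)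
    (hC : 0 ≤ C) (hγ : γ₀ < 1) :
    0 ≤ d.C0 χ CΦ C γ₀ :=
  div_nonneg (mul_nonneg hCΦ.le (d.gamma_nonneg hχ hC)) (by linarith)

theorem eps0_pos {m : ℕ} (d : Problem m) {χ CΦ γ₀ : ℝ} (hχ : 0 < χ) (hCΦ : 0 < CΦ) (hγ : 0 < γ₀) :
    0 < d.eps0 χ CΦ γ₀ := by
  unfold eps0
  split_ifs with h
  · exact EReal.zero_lt_top
  · have : 0 < d.beta χ := lt_of_le_of_ne (d.beta_nonneg hχ) (Ne.symm h)
    exact_mod_cast (by positivity : 0 < γ₀ / (CΦ * d.beta χ))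

theorem mul_beta_le {m : ℕ} (d : Problem m) {χ CΦ γ₀ ε : ℝ} (hχ : 0 < χ) (hCΦ : 0 < CΦ)
    (hγ : 0 < γ₀)
    (hε : (ε : EReal) ≤ d.eps0 χ CΦ γ₀) : CΦ * (ε * d.beta χ) ≤ γ₀ := by
  unfold eps0 at hε
  split_ifs at hε with h
  · simp [h, hγ.le]
  · have hβ : 0 < d.beta χ := lt_of_le_of_ne (d.beta_nonneg hχ) (Ne.symm h)
    have := (le_div_iff₀ (by positivity)).1 (EReal.coe_le_coe_iff.1 hε)
    linarith

/-- The standing assumptions on the data. -/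
structure Regular {m : ℕ} (d : Problem m) : Prop where
  X_pos : 0 < d.X
  contDiffOn_a : ∀ i, ContDiffOn ℝ 1 (d.a i) (Icc 0 d.X)
  contDiffOn_b : ContDiffOn ℝ 1 d.b (Icc 0 d.X)
  routhHurwitz : ∀ x ∈ Icc 0 d.X, RouthHurwitz (d.coeff x)

namespace Regular

/-- The Hurwitz determinant of order one is `a_0` itself. Hence `ybar` is continuously
differentiable. -/
theorem a_zero_ne_zero {m : ℕ} [NeZero m] {d : Problem m} (h : d.Regular) {x : ℝ}
    (hx : x ∈ Icc 0 d.X) : d.a 0 x ≠ 0 := by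
  have hm := NeZero.pos m
  have := h.routhHurwitz x hx 1 le_rfl hm
  intro h0
  have e : hurwitzEntry (d.coeff x) 0 0 = d.a 0 x := by
    simp [hurwitzEntry, hm, coeff]
  simp [e, h0] at this

theorem continuousOn_a {m : ℕ} {d : Problem m} (h : d.Regular) (j : Fin m) :
    ContinuousOn (d.a j) (Icc 0 d.X) := (h.contDiffOn_a j).continuousOn

theorem continuousOn_coeff {m : ℕ} {d : Problem m} (h : d.Regular) :
    ContinuousOn d.coeff (Icc 0 d.X) := continuousOn_pi.2 fun j => h.continuousOn_a j

theorem continuousOn_ybar' {m : ℕ} [NeZero m] {d : Problem m} (h : d.Regular) :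
    ContinuousOn d.ybar' (Icc 0 d.X) :=
  ((h.contDiffOn_b.div (h.contDiffOn_a 0) fun _ hx => h.a_zero_ne_zero hx).neg
    ).continuousOn_derivWithin (uniqueDiffOn_Icc h.X_pos) le_rfl

theorem abs_a_sub_le {m : ℕ} {d : Problem m} (h : d.Regular) (j : Fin m) {x y : ℝ}
    (hx : x ∈ Icc 0 d.X) (hy : y ∈ Icc 0 d.X) :
    |d.a j x - d.a j y| ≤ d.supNorm (derivWithin (d.a j) (Icc 0 d.X)) * |x - y| :=
  (convex_Icc 0 d.X).norm_image_sub_le_of_norm_derivWithin_le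
    ((h.contDiffOn_a j).differentiableOn one_ne_zero)
    (fun _ hz => d.abs_le_supNorm
      ((h.contDiffOn_a j).continuousOn_derivWithin (uniqueDiffOn_Icc h.X_pos) le_rfl) hz)
    hy hx

end Regular

theorem mul_mem_Icc {X ε ξ : ℝ} (hε : 0 < ε) (hξ : ξ ∈ Icc 0 (X / ε)) : ε * ξ ∈ Icc 0 X :=
  ⟨mul_nonneg hε.le hξ.1, by rw [mul_comm]; exact (le_div_iff₀ hε).1 hξ.2⟩

/-! ### `Â(ε)` acts on `C_m[0, X/ε]` -/

theorem continuous_iteratedDeriv_bl {m : ℕ} [NeZero m] (d : Problem m) (j : Fin m) :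
    Continuous (iteratedDeriv (j : ℕ) d.bl) := by
  unfold bl
  generalize (fun j : Fin m => if j = 0 then d.y0 0 - d.ybar 0 else d.y0 j) = N
  rw [← continuousOn_univ]
  exact continuousOn_iteratedDeriv_ivpSol_comp N j (c := fun _ => d.coeff 0) (g := fun t => t)
    continuousOn_const continuousOn_id

theorem Regular.continuousOn_comp_mul {m : ℕ} {d : Problem m} {g : ℝ → ℝ}
    (hg : ContinuousOn g (Icc 0 d.X)) {ε : ℝ} (hε : 0 < ε) :
    ContinuousOn (fun ξ => g (ε * ξ)) (Icc 0 (d.X / ε)) :=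
  hg.comp (by fun_prop) fun _ hξ => mul_mem_Icc hε hξ

theorem Regular.continuousOn_f {m : ℕ} [NeZero m] {d : Problem m} (h : d.Regular) {ε : ℝ}
    (hε : 0 < ε) : ContinuousOn (d.f ε) (Icc 0 (d.X / ε)) := by
  have ha : ∀ j, ContinuousOn (fun ξ => d.a j (ε * ξ)) (Icc 0 (d.X / ε)) := fun j =>
    Regular.continuousOn_comp_mul (h.continuousOn_a j) hε
  have hy := Regular.continuousOn_comp_mul h.continuousOn_ybar' hε
  have hbl := d.continuous_iteratedDeriv_bl
  unfold f
  split_ifs with hm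
  · exact continuousOn_const.mul (continuousOn_finsetSum _ fun j _ =>
      ((ha j).sub continuousOn_const).mul (hbl j).continuousOn)
  · have h0 : Continuous d.bl := by simpa using hbl 0
    exact (continuousOn_const.mul (((ha 0).sub continuousOn_const).mul h0.continuousOn)).sub hy

theorem Regular.mapsTo_Ahat {m : ℕ} [NeZero m] {d : Problem m} (h : d.Regular) {ε : ℝ}
    (hε : 0 < ε) : MapsTo (d.Ahat ε) (d.Cm ε) (d.Cm ε) := by
  intro z hz
  have hz' : ContinuousOn z (Icc 0 (d.X / ε)) := hz
  set S := Icc 0 (d.X / ε) with hS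
  have hT : 0 ≤ d.X / ε := (div_pos h.X_pos hε).le
  have h1 : MapsTo (Prod.fst : ℝ × ℝ → ℝ) (S ×ˢ S) S := fun q hq => hq.1
  have h2 : MapsTo (Prod.snd : ℝ × ℝ → ℝ) (S ×ˢ S) S := fun q hq => hq.2
  have hsol : ∀ (N : Fin m → ℝ) (i : Fin m), ContinuousOn (fun q : ℝ × ℝ =>
      iteratedDeriv (i : ℕ) (ivpSol (d.coeff (ε * q.1)) N) (q.1 - q.2)) (S ×ˢ S) := by
    intro N i
    have hc : ContinuousOn (fun q : ℝ × ℝ => d.coeff (ε * q.1)) (S ×ˢ S) :=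
      h.continuousOn_coeff.comp (by fun_prop) fun q hq => mul_mem_Icc hε hq.1
    exact continuousOn_iteratedDeriv_ivpSol_comp N i hc (g := fun q => q.1 - q.2) (by fun_prop)
  have ha : ∀ j, ContinuousOn (fun ξ => d.a j (ε * ξ)) S := fun j =>
    Regular.continuousOn_comp_mul (h.continuousOn_a j) hε
  have hy := Regular.continuousOn_comp_mul h.continuousOn_ybar' hε
  refine continuousOn_pi.2 fun i => ContinuousOn.add ?_ ?_
  · by_cases hm : 2 ≤ m
    · simp only [if_pos hm]
      refine (continuousOn_integral_of_continuousOn hT ?_).neg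
      exact (hsol _ i).mul (hy.comp continuousOn_snd h2)
    · simp only [if_neg hm]
      exact continuousOn_const
  · refine continuousOn_integral_of_continuousOn hT ?_
    refine (hsol _ i).mul (ContinuousOn.add (continuousOn_finsetSum _ fun j _ => ?_)
      ((h.continuousOn_f hε).comp continuousOn_snd h2))
    exact (((ha j).comp continuousOn_snd h2).sub ((ha j).comp continuousOn_fst h1)).mul
      ((continuousOn_pi.1 hz' j).comp continuousOn_snd h2)

/-! ### Existence of the constants -/

theorem Regular.exists_sum_le {m : ℕ} {d : Problem m} (h : d.Regular) :
    ∃ S, ∀ x ∈ Icc 0 d.X, ∑ j, |d.coeff x j| ≤ S := by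
  have hc : ContinuousOn (fun x => ∑ j, |d.coeff x j|) (Icc 0 d.X) :=
    continuousOn_finsetSum _ fun j _ => (h.continuousOn_a j).abs
  obtain ⟨S, hS⟩ := isCompact_Icc.bddAbove_image hc
  exact ⟨S, fun x hx => hS (mem_image_of_mem _ hx)⟩

/-- The pairs `(x, λ)` with `λ` a root at `x` form a closed subset of a compact set, so the maximal
real part is attained at an actual root, where `RouthHurwitz.re_neg` applies. -/
theorem Regular.exists_isGreatest_rootRe {m : ℕ} [NeZero m] {d : Problem m} (h : d.Regular) :
    ∃ χ, 0 < χ ∧ IsGreatest d.rootRe (-χ) := by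
  obtain ⟨S, hS⟩ := h.exists_sum_le
  set P : ℝ × ℂ → ℂ := fun q => q.2 ^ m - ∑ j : Fin m, (d.a j q.1 : ℂ) * q.2 ^ (j : ℕ) with hP
  set K : Set (ℝ × ℂ) := Icc 0 d.X ×ˢ Metric.closedBall 0 (1 + S) with hK
  have hKc : IsCompact K := isCompact_Icc.prod (isCompact_closedBall _ _)
  have hPc : ContinuousOn P K := by
    refine ContinuousOn.sub (by fun_prop) (continuousOn_finsetSum _ fun j _ => ?_)
    refine ContinuousOn.mul (Complex.continuous_ofReal.comp_continuousOn ?_) (by fun_prop)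
    exact (h.continuousOn_a j).comp continuousOn_fst fun q hq => hq.1
  have hZ : IsCompact (K ∩ P ⁻¹' {0}) :=
    hKc.of_isClosed_subset (hPc.preimage_isClosed_of_isClosed hKc.isClosed isClosed_singleton)
      inter_subset_left
  have e : d.rootRe = (fun q : ℝ × ℂ => q.2.re) '' (K ∩ P ⁻¹' {0}) := by
    ext r
    constructor
    · rintro ⟨x, hx, l, hl, rfl⟩
      refine ⟨(x, l), ⟨⟨hx, ?_⟩, hl⟩, rfl⟩
      rw [mem_closedBall_zero_iff]
      exact (norm_root_le (d.coeff x) hl).trans (by linarith [hS x hx])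
    · rintro ⟨⟨x, l⟩, ⟨⟨hx, _⟩, hl⟩, rfl⟩
      exact ⟨x, hx, l, hl, rfl⟩
  have hne : d.rootRe.Nonempty := by
    have hdeg : (charPoly (d.coeff 0)).degree ≠ 0 := by
      rw [Polynomial.degree_eq_natDegree (monic_charPoly _).ne_zero, natDegree_charPoly]
      exact_mod_cast NeZero.ne m
    obtain ⟨l, hl⟩ := IsAlgClosed.exists_root _ hdeg
    exact ⟨l.re, 0, left_mem_Icc.2 h.X_pos.le, l, (eval_charPoly _ _).symm.trans hl, rfl⟩
  have hcomp : IsCompact d.rootRe := by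
    rw [e]
    exact hZ.image (Complex.continuous_re.comp continuous_snd)
  obtain ⟨r, hr⟩ := hcomp.exists_isGreatest hne
  refine ⟨-r, ?_, by rwa [neg_neg]⟩
  obtain ⟨x, hx, l, hl, rfl⟩ := hr.1
  have := (h.routhHurwitz x hx).re_neg hl
  linarith

theorem Regular.exists_PhiBound {m : ℕ} [NeZero m] {d : Problem m} (h : d.Regular) {χ : ℝ}
    (hχ : IsGreatest d.rootRe (-χ)) : ∃ CΦ, 0 < CΦ ∧ d.PhiBound χ CΦ := by
  obtain ⟨S, hS⟩ := h.exists_sum_le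
  have hS0 : 0 ≤ S := (Finset.sum_nonneg fun _ _ => abs_nonneg _).trans
    (hS 0 (left_mem_Icc.2 h.X_pos.le))
  set Q : ℝ := ∑ k ∈ Finset.range m, (2 * (1 + S)) ^ k / k.factorial with hQ
  -- The term `k = 0` guarantees that the sum is nonempty.
  have hQ0 : 0 < Q := Finset.sum_pos (fun k _ => by positivity) ⟨0, by simp [NeZero.pos m]⟩
  have key : ∀ (n : ℕ) (i : Fin m) (ξ : ℝ), 0 ≤ ξ → ∀ x ∈ Icc 0 d.X,
      |iteratedDeriv (i : ℕ) (ivpSol (d.coeff x) (fun j => if (j : ℕ) = n then 1 else 0)) ξ| ≤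
        Q * (1 + ξ ^ (m - 1)) * Real.exp (-(χ * ξ)) := by
    intro n i ξ hξ x hx
    refine (abs_iteratedDeriv_ivpSol_le (d.coeff x) _ (hS x hx)
      (fun l hl => hχ.2 ⟨x, hx, l, hl, rfl⟩) i hξ).trans ?_
    gcongr
    refine mul_le_of_le_one_right hQ0.le ((pi_norm_le_iff_of_nonneg zero_le_one).2 fun j => ?_)
    split_ifs <;> simp
  exact ⟨Q, hQ0, fun i ξ hξ x hx => ⟨key 0 i ξ hξ x hx, key (m - 1) i ξ hξ x hx⟩⟩

theorem Regular.exists_BlBound {m : ℕ} [NeZero m] {d : Problem m} (h : d.Regular) {χ : ℝ}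
    (hχ : IsGreatest d.rootRe (-χ)) : ∃ C, d.BlBound χ C :=
  ⟨_, fun i _ hξ => abs_iteratedDeriv_ivpSol_le (d.coeff 0) _ le_rfl
    (fun l hl => hχ.2 ⟨0, left_mem_Icc.2 h.X_pos.le, l, hl, rfl⟩) i hξ⟩

/-! ### Invariance of the ball -/

/-- The mean value inequality yields a factor `ε ζ`: the `ε` cancels `ε⁻¹`, and `ζ` times `1 +
ζ^(m-1)` gives the function maximized in `gamma`. -/
theorem Regular.abs_f_le {m : ℕ} [NeZero m] {d : Problem m} (h : d.Regular) {χ C ε ζ : ℝ}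
    (hχ : 0 < χ) (hC : d.BlBound χ C) (hε : 0 < ε) (hζ : 0 < ζ) (hζX : ζ ≤ d.X / ε) :
    |d.f ε ζ| ≤
      C * d.alpha * sSup ((fun ζ : ℝ => (ζ + ζ ^ m) * Real.exp (-(χ * ζ))) '' Ioi 0) +
        if 2 ≤ m then 0 else d.supNorm d.ybar' := by
  have hC0 := hC.nonneg
  set s := sSup ((fun ζ : ℝ => (ζ + ζ ^ m) * Real.exp (-(χ * ζ))) '' Ioi 0) with hs
  have hle : (ζ + ζ ^ m) * Real.exp (-(χ * ζ)) ≤ s :=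
    le_csSup (bddAbove_add_pow_mul_exp m hχ) (mem_image_of_mem _ hζ)
  have hm : ζ * (1 + ζ ^ (m - 1)) = ζ + ζ ^ m := by
    rw [mul_add, mul_one, mul_comm ζ (ζ ^ (m - 1)), pow_sub_one_mul (NeZero.ne m)]
  have hmem := mul_mem_Icc hε ⟨hζ.le, hζX⟩
  have hterm : ∀ j : Fin m,
      |(d.a j (ε * ζ) - d.a j 0) * iteratedDeriv (j : ℕ) d.bl ζ| ≤
        ε * (C * d.supNorm (derivWithin (d.a j) (Icc 0 d.X)) * s) := by
    intro j
    have h1 := h.abs_a_sub_le j hmem (left_mem_Icc.2 h.X_pos.le)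
    rw [sub_zero, abs_of_pos (mul_pos hε hζ)] at h1
    have hn := d.supNorm_nonneg (derivWithin (d.a j) (Icc 0 d.X))
    rw [abs_mul]
    calc _ ≤ (d.supNorm (derivWithin (d.a j) (Icc 0 d.X)) * (ε * ζ)) *
          (C * (1 + ζ ^ (m - 1)) * Real.exp (-(χ * ζ))) :=
          mul_le_mul h1 (hC j ζ hζ.le) (abs_nonneg _) (by positivity)
      _ = ε * (C * d.supNorm (derivWithin (d.a j) (Icc 0 d.X)) *
          ((ζ * (1 + ζ ^ (m - 1))) * Real.exp (-(χ * ζ)))) := by ring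
      _ ≤ _ := by
          rw [hm]
          gcongr
  unfold f
  split_ifs with h2
  · rw [abs_mul, abs_of_pos (inv_pos.2 hε), inv_mul_le_iff₀ hε, add_zero]
    refine (Finset.abs_sum_le_sum_abs _ _).trans
      ((Finset.sum_le_sum fun j _ => hterm j).trans_eq ?_)
    rw [alpha, ← Finset.mul_sum, ← Finset.sum_mul, ← Finset.mul_sum]
  · refine (abs_sub _ _).trans (add_le_add ?_ (d.abs_le_supNorm h.continuousOn_ybar' hmem))
    have hα : d.supNorm (derivWithin (d.a 0) (Icc 0 d.X)) ≤ d.alpha :=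
      Finset.single_le_sum (f := fun j => d.supNorm (derivWithin (d.a j) (Icc 0 d.X)))
        (fun _ _ => d.supNorm_nonneg _) (Finset.mem_univ 0)
    rw [abs_mul, abs_of_pos (inv_pos.2 hε), inv_mul_le_iff₀ hε]
    have h0 := hterm 0
    simp only [Fin.val_zero, iteratedDeriv_zero] at h0
    refine h0.trans ?_
    have hs0 : 0 ≤ s := sSup_nonneg_add_pow_mul_exp m χ
    gcongr

/-- The differences of the `a_j` yield `β`, with one factor `ε`; `f` and `ybar'` yield `γ`. -/
theorem Regular.abs_Ahat_le {m : ℕ} [NeZero m] {d : Problem m} (h : d.Regular)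
    {χ CΦ C C₀ ε : ℝ} (hχ : 0 < χ) (hCΦ : 0 < CΦ) (hΦ : d.PhiBound χ CΦ) (hC : d.BlBound χ C)
    (hC₀ : 0 ≤ C₀) (hε : 0 < ε) {z : ℝ → Fin m → ℝ} (hz : z ∈ d.closedNhd C₀ ε) {ξ : ℝ}
    (hξ : ξ ∈ Icc 0 (d.X / ε)) (i : Fin m) :
    |d.Ahat ε z ξ i| ≤ CΦ * (ε * d.beta χ * C₀ + d.gamma χ C) := by
  have hC0 := hC.nonneg
  have hα := d.alpha_nonneg
  have hy0 := d.supNorm_nonneg d.ybar'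
  set k : ℝ → ℝ := fun s => (1 + s ^ (m - 1)) * Real.exp (-(χ * s)) with hk
  set s₀ := sSup ((fun ζ : ℝ => (ζ + ζ ^ m) * Real.exp (-(χ * ζ))) '' Ioi 0) with hs₀
  have hs0 : 0 ≤ s₀ := sSup_nonneg_add_pow_mul_exp m χ
  set Y := d.supNorm d.ybar' with hY
  set F := C * d.alpha * s₀ + if 2 ≤ m then 0 else Y with hF
  have hF0 : 0 ≤ F := by
    have : 0 ≤ if 2 ≤ m then 0 else Y := by split_ifs <;> simp [hy0]
    positivity
  have hkc : Continuous k := by fun_prop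
  have hI1 := integral_kernel_le m hχ hξ.1
  have hI2 := integral_mul_kernel_le m hχ hξ.1
  have hx := mul_mem_Icc hε hξ
  have hmem : ∀ ζ ∈ Ioc 0 ξ, ε * ζ ∈ Icc 0 d.X := fun ζ hζ =>
    mul_mem_Icc hε ⟨hζ.1.le, hζ.2.trans hξ.2⟩
  have b1 : |∫ ζ in (0 : ℝ)..ξ, iteratedDeriv (i : ℕ) (d.Phi1 (ε * ξ)) (ξ - ζ) *
      d.ybar' (ε * ζ)| ≤ CΦ * (Y * ((χ ^ (m - 1) + ((m - 1).factorial : ℝ)) / χ ^ m)) := by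
    rw [← Real.norm_eq_abs]
    refine (intervalIntegral.norm_integral_le_of_norm_le
      (g := fun ζ => CΦ * Y * k (ξ - ζ)) hξ.1
      (Filter.Eventually.of_forall fun ζ hζ => ?_)
      (Continuous.intervalIntegrable (by fun_prop) _ _)).trans ?_
    · rw [Real.norm_eq_abs, abs_mul]
      have h1 := (hΦ i (ξ - ζ) (by linarith [hζ.2]) _ hx).1
      have h2 := d.abs_le_supNorm h.continuousOn_ybar' (hmem ζ hζ)
      rw [mul_assoc] at h1
      refine (mul_le_mul h1 h2 (abs_nonneg _) ?_).trans_eq (by ring)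
      exact (abs_nonneg _).trans h1
    · rw [intervalIntegral.integral_const_mul, intervalIntegral.integral_comp_sub_left k ξ,
        sub_self, sub_zero, mul_assoc]
      gcongr
  have b2 : |∫ ζ in (0 : ℝ)..ξ, iteratedDeriv (i : ℕ) (d.Phim (ε * ξ)) (ξ - ζ) *
      ((∑ j : Fin m, (d.a j (ε * ζ) - d.a j (ε * ξ)) * z ζ j) + d.f ε ζ)| ≤
      CΦ * (ε * d.beta χ * C₀ + F * ((χ ^ (m - 1) + ((m - 1).factorial : ℝ)) / χ ^ m)) := by
    rw [← Real.norm_eq_abs]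
    refine (intervalIntegral.norm_integral_le_of_norm_le
      (g := fun ζ => CΦ * (ε * d.alpha * C₀) * ((ξ - ζ) * k (ξ - ζ)) + CΦ * F * k (ξ - ζ)) hξ.1
      (Filter.Eventually.of_forall fun ζ hζ => ?_)
      (Continuous.intervalIntegrable (by fun_prop) _ _)).trans ?_
    · have hξζ : 0 ≤ ξ - ζ := by linarith [hζ.2]
      have h1 := (hΦ i (ξ - ζ) hξζ _ hx).2
      have h2 := h.abs_f_le hχ hC hε hζ.1 (hζ.2.trans hξ.2)
      have h3 : |∑ j : Fin m, (d.a j (ε * ζ) - d.a j (ε * ξ)) * z ζ j| ≤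
          d.alpha * (ε * (ξ - ζ)) * C₀ := by
        rw [alpha, Finset.sum_mul, Finset.sum_mul]
        refine (Finset.abs_sum_le_sum_abs _ _).trans (Finset.sum_le_sum fun j _ => ?_)
        have h4 := h.abs_a_sub_le j (hmem ζ hζ) hx
        rw [← mul_sub, abs_mul, abs_of_pos hε, abs_sub_comm ζ ξ, abs_of_nonneg hξζ] at h4
        rw [abs_mul]
        exact mul_le_mul h4 (abs_le.2 (hz.2 ζ ⟨hζ.1.le, hζ.2.trans hξ.2⟩ j)) (abs_nonneg _)
          ((abs_nonneg _).trans h4)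
      rw [Real.norm_eq_abs, abs_mul]
      rw [mul_assoc] at h1
      refine (mul_le_mul h1 ((abs_add_le _ _).trans (add_le_add h3 h2)) (abs_nonneg _)
        ((abs_nonneg _).trans h1)).trans_eq ?_
      ring
    · rw [intervalIntegral.integral_add (Continuous.intervalIntegrable (by fun_prop) _ _)
        (Continuous.intervalIntegrable (by fun_prop) _ _), intervalIntegral.integral_const_mul,
        intervalIntegral.integral_const_mul, intervalIntegral.integral_comp_sub_left k ξ,
        intervalIntegral.integral_comp_sub_left (fun s => s * k s) ξ, sub_self, sub_zero,
        mul_add CΦ (ε * d.beta χ * C₀)]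
      have e : CΦ * (ε * d.beta χ * C₀) = CΦ * (ε * d.alpha * C₀) *
          ((χ ^ (m - 1) + (m.factorial : ℝ)) / χ ^ (m + 1)) := by
        rw [beta]
        ring
      rw [e, ← mul_assoc CΦ F]
      gcongr
  unfold Ahat
  refine (abs_add_le _ _).trans ?_
  -- The term `‖ybar'‖` enters exactly once: through the `Phi1` integral if `m ≥ 2`, through `f` if
  -- `m = 1`. So `γ` is the same expression in both cases.
  by_cases hm : 2 ≤ m
  · rw [if_pos hm, abs_neg]
    refine (add_le_add b1 b2).trans_eq ?_
    rw [hF, if_pos hm, gamma]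
    ring
  · rw [if_neg hm, abs_zero, zero_add]
    refine b2.trans_eq ?_
    rw [hF, if_neg hm, gamma]

theorem Regular.mapsTo_closedNhd {m : ℕ} [NeZero m] {d : Problem m} (h : d.Regular)
    {χ CΦ C γ₀ ε : ℝ} (hχ : 0 < χ) (hCΦ : 0 < CΦ) (hΦ : d.PhiBound χ CΦ) (hC : d.BlBound χ C)
    (hγ : 0 < γ₀) (hγ' : γ₀ < 1) (hε : 0 < ε) (hε' : (ε : EReal) ≤ d.eps0 χ CΦ γ₀) :
    MapsTo (d.Ahat ε) (d.closedNhd (d.C0 χ CΦ C γ₀) ε) (d.closedNhd (d.C0 χ CΦ C γ₀) ε) := by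
  intro z hz
  have hC₀ : 0 ≤ d.C0 χ CΦ C γ₀ := d.C0_nonneg hχ hCΦ hC.nonneg hγ'
  refine ⟨h.mapsTo_Ahat hε hz.1, fun ξ hξ i => abs_le.1 ?_⟩
  refine (h.abs_Ahat_le hχ hCΦ hΦ hC hC₀ hε hz hξ i).trans ?_
  -- `C0` is the solution of `C₀ = γ₀ C₀ + CΦ γ`, which is where the estimate closes.
  have h1 := mul_le_mul_of_nonneg_right (d.mul_beta_le hχ hCΦ hγ hε') hC₀
  have h2 : d.C0 χ CΦ C γ₀ * (1 - γ₀) = CΦ * d.gamma χ C :=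
    div_mul_cancel₀ _ (by linarith)
  linarith

end Problem
end SingPert

theorem mainTheorem3 (m : ℕ) [NeZero m] (d : SingPert.Problem m) (hX : 0 < d.X)
    (ha : ∀ i, ContDiffOn ℝ 1 (d.a i) (Set.Icc 0 d.X))
    (hb : ContDiffOn ℝ 1 d.b (Set.Icc 0 d.X))
    (hRH : ∀ x ∈ Set.Icc 0 d.X, SingPert.RouthHurwitz (d.coeff x)) :
    -- `Â(ε)` is an operator on `C_m[0, X/ε]`
    (∀ ε : ℝ, 0 < ε → Set.MapsTo (d.Ahat ε) (d.Cm ε) (d.Cm ε)) ∧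
    -- invariance of the ball
    (∃ ε₀ : ℝ, 0 < ε₀ ∧ ∃ C₀ : ℝ, 0 ≤ C₀ ∧ ∀ ε : ℝ, 0 < ε → ε ≤ ε₀ →
      Set.MapsTo (d.Ahat ε) (d.closedNhd C₀ ε) (d.closedNhd C₀ ε)) ∧
    -- constants `χ`, `C_Φ`, `C` as used in the explicit formulas exist
    (∃ χ : ℝ, 0 < χ ∧ IsGreatest d.rootRe (-χ) ∧
      (∃ CΦ : ℝ, 0 < CΦ ∧ d.PhiBound χ CΦ) ∧ ∃ C : ℝ, d.BlBound χ C) ∧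
    -- the explicit values of `ε₀` and `C₀`
    (∀ χ CΦ C γ₀ : ℝ, 0 < χ → 0 < CΦ → d.PhiBound χ CΦ → d.BlBound χ C →
      0 < γ₀ → γ₀ < 1 →
      0 < d.eps0 χ CΦ γ₀ ∧ 0 ≤ d.C0 χ CΦ C γ₀ ∧
      ∀ ε : ℝ, 0 < ε → (ε : EReal) ≤ d.eps0 χ CΦ γ₀ →
        Set.MapsTo (d.Ahat ε) (d.closedNhd (d.C0 χ CΦ C γ₀) ε)
          (d.closedNhd (d.C0 χ CΦ C γ₀) ε)) := by
  have h : d.Regular := ⟨hX, ha, hb, hRH⟩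
  obtain ⟨χ, hχ, hg⟩ := h.exists_isGreatest_rootRe
  obtain ⟨CΦ, hCΦ, hΦ⟩ := h.exists_PhiBound hg
  obtain ⟨C, hC⟩ := h.exists_BlBound hg
  refine ⟨fun ε hε => h.mapsTo_Ahat hε, ?_,
    ⟨χ, hχ, hg, ⟨CΦ, hCΦ, hΦ⟩, C, hC⟩, fun χ CΦ C γ₀ hχ hCΦ hΦ hC hγ hγ' =>
      ⟨d.eps0_pos hχ hCΦ hγ, d.C0_nonneg hχ hCΦ hC.nonneg hγ', fun ε hε hε' =>
        h.mapsTo_closedNhd hχ hCΦ hΦ hC hγ hγ' hε hε'⟩⟩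
  -- Since `eps0` may be `+∞`, a positive real below it is chosen, with `γ₀ = 1/2`.
  obtain ⟨ε₀, hε₀, hle⟩ := EReal.lt_iff_exists_real_btwn.1
    (d.eps0_pos hχ hCΦ (one_half_pos (α := ℝ)))
  exact ⟨ε₀, by exact_mod_cast hε₀, d.C0 χ CΦ C (1 / 2),
    d.C0_nonneg hχ hCΦ hC.nonneg one_half_lt_one, fun ε hε hεε₀ =>
      h.mapsTo_closedNhd hχ hCΦ hΦ hC one_half_pos one_half_lt_one hε
        ((EReal.coe_le_coe_iff.2 hεε₀).trans hle.le)⟩
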